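/- Let $\alpha,\beta>0$ and let $V:\mathbb{R}\to\mathbb{R}$ be defined by $V(x)=0$ for $x\in[-\frac{\pi}{2},\frac{\pi}{2}]$, $V(x)=\frac{\alpha}{2}(x-\frac{\pi}{2})^2$ for $x>\frac{\pi}{2}$ and $V(x)=\frac{\beta}{2}(x+\frac{\pi}{2})^2$ for $x<-\frac{\pi}{2}$. For $t>0$ let $\mu_t$ be the probability measure on $\mathbb{R}$ with Lebesgue density $\frac{1}{Z_t}e^{-V/t}$, where $Z_t=\int_{\mathbb{R}}e^{-V(x)/t}\,dx$, and let $C_{\mathrm{P}}(\mu_t)\in[0,+\infty]$ be its Poincaré constant, i.e. the smallest constant $C$ such that $$\int h^2\,d\mu_t-\Big(\int h\,d\mu_t\Big)^2\le C\int |h'|^2\,d\mu_t$$ for all smooth compactly supported functions $h:\mathbb{R}\to\mathbb{R}$. Then $C_{\mathrm{P}}(\mu_t)$ is finite for all sufficiently small $t>0$, and $$C_{\mathrm{P}}(\mu_t)=1+\Big(\frac{1}{\sqrt{\alpha}}+\frac{1}{\sqrt{\beta}}\Big)\sqrt{\frac{2t}{\pi}}+o(\sqrt{t})\qquad\text{as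 } t\to0^+.$$ -/

import Mathlib

open MeasureTheory Filter Topology Asymptotics
open scoped ContDiff NNReal ENNReal

noncomputable section

/-- The measure `μ` on `ℝ` satisfies a Poincaré inequality with constant `C`:
`∫ h² dμ - (∫ h dμ)² ≤ C ∫ |h'|² dμ` for all smooth compactly supported `h`. -/
def SatisfiesPoincare (μ : Measure ℝ) (C : ℝ≥0) : Prop :=
  ∀ h : ℝ → ℝ, ContDiff ℝ ∞ h → HasCompactSupport h →
    (∫ x, h x ^ 2 ∂μ) - (∫ x, h x ∂μ) ^ 2 ≤ C * ∫ x, deriv h x ^ 2 ∂μ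

/-- The best constant in the Poincaré inequality for `μ`, with value in `[0, ∞]`
(`∞` if no finite constant is admissible). -/
def poincareConst (μ : Measure ℝ) : ℝ≥0∞ :=
  ⨅ (C : ℝ≥0) (_ : SatisfiesPoincare μ C), (C : ℝ≥0∞)

/-- The potential that vanishes on `[-π/2, π/2]` and is quadratic outside of it, with
coefficient `α / 2` on the right and `β / 2` on the left. -/
def flatPotential (α β x : ℝ) : ℝ :=
  if Real.pi / 2 < x then α / 2 * (x - Real.pi / 2) ^ 2
  else if x < -(Real.pi / 2) then β / 2 * (x + Real.pi / 2) ^ 2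
  else 0

/-- The Gibbs measure at temperature `t`, i.e. the measure with Lebesgue density
`exp (-V x / t) / ∫ exp (-V y / t) dy`. -/
def gibbsMeasure (V : ℝ → ℝ) (t : ℝ) : Measure ℝ :=
  (volume : Measure ℝ).tilted (fun x => -V x / t)

end

/-! Write `a`, `b` for `√(π / (2α))`, `√(π / (2β))`. On the flat interval of length `π` the first
nonzero Neumann eigenvalue is 1, with eigenfunction sine. The Gaussian tails, of mass `m = a√t` and
`b√t`, act to first order as point masses at the endpoints, which lengthens the quarter waves by
these amounts.

Upper bound: pick a point `x₀` of the flat part and subtract `h x₀`. On each side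
`half_line_poincare` glues a sine comparison on the flat part to a tail estimate, so that the
boundary terms at `±π/2` cancel. The same wave number `k = 1 - (a + b)√t / π + O(t)` serves both
sides, and `1 / k ^ 2` is admissible.

Lower bound: the Rayleigh quotient of a cut-off sine has the same first-order expansion
(`exists_lower_bound`). A squeeze concludes. -/

/-! ### The Gibbs weight and its Gaussian tails. -/

/-- The unnormalised density `exp (-V / t)` of the Gibbs measure of the flat potential. -/
noncomputable def gibbsWeight (α β t x : ℝ) : ℝ := Real.exp (-flatPotential α β x / t)

/-- The mass `∫ y in (0, ∞), exp (-(α / 2) y² / t)` of a Gaussian half-tail. -/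
noncomputable def tailMass (α t : ℝ) : ℝ := √(Real.pi / (α / (2 * t))) / 2

/-- This symmetry lets every statement on the left tail follow from the right one with `α` and `β`
exchanged. -/
lemma flatPotential_neg (α β x : ℝ) : flatPotential α β (-x) = flatPotential β α x := by
  have := Real.pi_pos
  unfold flatPotential
  split_ifs <;> first | (exfalso; linarith) | ring

lemma gibbsWeight_neg (α β t x : ℝ) : gibbsWeight α β t (-x) = gibbsWeight β α t x := by
  rw [gibbsWeight, gibbsWeight, flatPotential_neg]

lemma gibbsWeight_pos (α β t x : ℝ) : 0 < gibbsWeight α β t x := Real.exp_pos _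

lemma gibbsWeight_of_mem {α β t x : ℝ} (h1 : -(Real.pi / 2) ≤ x) (h2 : x ≤ Real.pi / 2) :
    gibbsWeight α β t x = 1 := by
  unfold gibbsWeight flatPotential
  rw [if_neg (by linarith), if_neg (by linarith)]
  simp

lemma gibbsWeight_of_ge {α β t x : ℝ} (h : Real.pi / 2 ≤ x) :
    gibbsWeight α β t x = Real.exp (-(α / (2 * t)) * (x - Real.pi / 2) ^ 2) := by
  have := Real.pi_pos
  rcases h.eq_or_lt with h | h
  · rw [gibbsWeight_of_mem (by linarith) h.ge, ← h]; simp
  · unfold gibbsWeight flatPotential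
    rw [if_pos h]
    congr 1
    ring

lemma gibbsWeight_of_le {α β t x : ℝ} (h : x ≤ -(Real.pi / 2)) :
    gibbsWeight α β t x = Real.exp (-(β / (2 * t)) * (x + Real.pi / 2) ^ 2) := by
  rw [← neg_neg x, gibbsWeight_neg, gibbsWeight_of_ge (by linarith)]
  congr 1
  ring

lemma continuous_flatPotential (α β : ℝ) : Continuous (flatPotential α β) := by
  have hp := Real.pi_pos
  have h : flatPotential α β = fun x =>
      α / 2 * (max (x - Real.pi / 2) 0) ^ 2 + β / 2 * (min (x + Real.pi / 2) 0) ^ 2 := by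
    ext x
    unfold flatPotential
    split_ifs with h1 h2
    · rw [max_eq_left (by linarith), min_eq_right (by linarith)]; ring
    · rw [max_eq_right (by linarith), min_eq_left (by linarith)]; ring
    · rw [max_eq_right (by linarith), min_eq_right (by linarith)]; ring
  rw [h]
  fun_prop

lemma continuous_gibbsWeight (α β t : ℝ) : Continuous (gibbsWeight α β t) := by
  have := continuous_flatPotential α β
  unfold gibbsWeight
  fun_prop

lemma integrable_gibbsWeight {α β t : ℝ} (hα : 0 < α) (hβ : 0 < β) (ht : 0 < t) :
    Integrable (gibbsWeight α β t) := by
  have hp := Real.pi_pos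
  have h1 : Integrable fun x : ℝ => Real.exp (-(α / (2 * t)) * (x - Real.pi / 2) ^ 2) :=
    (integrable_exp_neg_mul_sq (by positivity : 0 < α / (2 * t))).comp_sub_right _
  have h2 : Integrable fun x : ℝ => Real.exp (-(β / (2 * t)) * (x + Real.pi / 2) ^ 2) :=
    (integrable_exp_neg_mul_sq (by positivity : 0 < β / (2 * t))).comp_add_right _
  have h3 : Integrable ((Set.Icc (-(Real.pi / 2)) (Real.pi / 2)).indicator fun _ : ℝ => (1 : ℝ)) :=
    (integrable_indicator_iff measurableSet_Icc).2 (by simp)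
  refine ((h1.add h2).add h3).mono' (continuous_gibbsWeight α β t).aestronglyMeasurable
    (ae_of_all _ fun x => ?_)
  rw [Real.norm_of_nonneg (gibbsWeight_pos _ _ _ _).le]
  have e1 := Real.exp_pos (-(α / (2 * t)) * (x - Real.pi / 2) ^ 2)
  have e2 := Real.exp_pos (-(β / (2 * t)) * (x + Real.pi / 2) ^ 2)
  have e3 : 0 ≤ (Set.Icc (-(Real.pi / 2)) (Real.pi / 2)).indicator (fun _ : ℝ => (1 : ℝ)) x :=
    Set.indicator_nonneg (fun _ _ => zero_le_one) _
  simp only [Pi.add_apply]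
  rcases le_total (Real.pi / 2) x with h | h
  · rw [gibbsWeight_of_ge h]; linarith
  rcases le_total x (-(Real.pi / 2)) with h' | h'
  · rw [gibbsWeight_of_le h']; linarith
  · rw [gibbsWeight_of_mem h' h, Set.indicator_of_mem (Set.mem_Icc.2 ⟨h', h⟩)]; linarith

/-- A continuous bounded function is integrable against the Gibbs weight. -/
lemma integrable_mul_gibbsWeight {α β t : ℝ} (hα : 0 < α) (hβ : 0 < β) (ht : 0 < t)
    {g : ℝ → ℝ} (hg : Continuous g) {B : ℝ} (hB : ∀ x, |g x| ≤ B) :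
    Integrable fun x => g x * gibbsWeight α β t x :=
  (integrable_gibbsWeight hα hβ ht).bdd_mul hg.aestronglyMeasurable (ae_of_all _ hB)

lemma integrable_energy_sub {α β t : ℝ} (hα : 0 < α) (hβ : 0 < β) (ht : 0 < t)
    {g g' : ℝ → ℝ} (hg : Continuous g) (hg' : Continuous g')
    {B B' : ℝ} (hB : ∀ x, |g x| ≤ B) (hB' : ∀ x, |g' x| ≤ B') (k : ℝ) :
    Integrable fun x => (g' x ^ 2 - k ^ 2 * g x ^ 2) * gibbsWeight α β t x := by
  refine integrable_mul_gibbsWeight hα hβ ht (by fun_prop) (B := B' ^ 2 + k ^ 2 * B ^ 2)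
    fun x => ?_
  have h1 : g x ^ 2 ≤ B ^ 2 := sq_le_sq.2 ((hB x).trans (le_abs_self _))
  have h2 : g' x ^ 2 ≤ B' ^ 2 := sq_le_sq.2 ((hB' x).trans (le_abs_self _))
  rw [abs_le]
  constructor <;> nlinarith [sq_nonneg (g x), sq_nonneg (g' x), sq_nonneg k,
    mul_le_mul_of_nonneg_left h1 (sq_nonneg k), mul_nonneg (sq_nonneg k) (sq_nonneg (g x)),
    sq_nonneg B, sq_nonneg B', mul_nonneg (sq_nonneg k) (sq_nonneg B)]

lemma setIntegral_Ioi_eq_shift (f : ℝ → ℝ) (c d : ℝ) :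
    ∫ x in Set.Ioi (d + c), f x = ∫ x in Set.Ioi d, f (x + c) := by
  have h := (measurePreserving_add_right (volume : Measure ℝ) c).setIntegral_preimage_emb
    (measurableEmbedding_addRight c) f (Set.Ioi (d + c))
  rw [← h]
  simp

lemma tailMass_nonneg (α t : ℝ) : 0 ≤ tailMass α t := by unfold tailMass; positivity

lemma tailMass_eq {α t : ℝ} (hα : 0 < α) (ht : 0 < t) :
    tailMass α t = √(Real.pi / (2 * α)) * √t := by
  have := Real.pi_pos
  unfold tailMass
  rw [← Real.sqrt_mul (by positivity), div_eq_iff (by norm_num),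
    show Real.pi / (α / (2 * t)) = (Real.pi / (2 * α) * t) * 2 ^ 2 by field_simp,
    Real.sqrt_mul (by positivity), Real.sqrt_sq (by norm_num)]

lemma integral_gibbsWeight_Ioi (α β t : ℝ) :
    ∫ x in Set.Ioi (Real.pi / 2), gibbsWeight α β t x = tailMass α t := by
  rw [← zero_add (Real.pi / 2), setIntegral_Ioi_eq_shift, tailMass, ← integral_gaussian_Ioi]
  refine setIntegral_congr_fun measurableSet_Ioi fun x hx => ?_
  simp only [Set.mem_Ioi] at hx
  rw [gibbsWeight_of_ge (by linarith)]
  simp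

/-- The Gaussian tail beyond `x` is at most the half-mass times the density at `x`. -/
lemma integral_gibbsWeight_Ioi_le {α β t x : ℝ} (hα : 0 < α) (hβ : 0 < β) (ht : 0 < t)
    (hx : Real.pi / 2 ≤ x) :
    ∫ y in Set.Ioi x, gibbsWeight α β t y ≤ tailMass α t * gibbsWeight α β t x := by
  rw [show x = Real.pi / 2 + (x - Real.pi / 2) by ring, setIntegral_Ioi_eq_shift,
    ← integral_gibbsWeight_Ioi α β t, ← integral_mul_const]
  refine setIntegral_mono_on ?_ ?_ measurableSet_Ioi fun y hy => ?_
  · exact ((integrable_gibbsWeight hα hβ ht).comp_add_right _).integrableOn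
  · exact ((integrable_gibbsWeight hα hβ ht).mul_const _).integrableOn
  · simp only [Set.mem_Ioi] at hy
    rw [gibbsWeight_of_ge (by linarith), gibbsWeight_of_ge (by linarith),
      gibbsWeight_of_ge (by linarith), ← Real.exp_add, Real.exp_le_exp]
    have h1 : 0 < α / (2 * t) := by positivity
    -- Dropping this cross term from the square of `(y - π/2) + (x - π/2)` bounds the shifted weight
    -- by the product of the weights at `y` and `x`.
    have h2 : 0 ≤ (y - Real.pi / 2) * (x - Real.pi / 2) :=
      mul_nonneg (by linarith) (by linarith)
    nlinarith [mul_nonneg h1.le h2]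

/-! ### Dirichlet inequalities on a half-line. -/

/-- Weighted Hardy inequality on the flat part `[x₀, π / 2]`, with a boundary term. -/
lemma flat_part_bound {g g' : ℝ → ℝ} (hg : ∀ x, HasDerivAt g (g' x) x) (hg' : Continuous g')
    {x₀ p k θ δ : ℝ} (hx₀ : x₀ ≤ p) (hg0 : g x₀ = 0) (hk : 0 < k) (hθ : 0 < θ) (hδ : 0 < δ)
    (hkp : k * (p - x₀) = Real.pi / 2 - δ - θ) :
    k * δ * g p ^ 2 ≤ ∫ x in x₀..p, (g' x ^ 2 - k ^ 2 * g x ^ 2) := by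
  have hpi := Real.pi_pos
  have hgc : Continuous g := continuous_iff_continuousAt.2 fun x => (hg x).continuousAt
  have hang : ∀ x, HasDerivAt (fun x => k * (x - x₀) + θ) k x := fun x => by
    simpa using (((hasDerivAt_id x).sub_const x₀).const_mul k).add_const θ
  have hsin : ∀ x ∈ Set.Icc x₀ p, 0 < Real.sin (k * (x - x₀) + θ) := fun x hx => by
    have h1 : 0 ≤ k * (x - x₀) := mul_nonneg hk.le (by linarith [hx.1])
    have h2 : k * (x - x₀) ≤ k * (p - x₀) := by gcongr; exact hx.2
    exact Real.sin_pos_of_pos_of_lt_pi (by linarith) (by linarith)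
  -- Logarithmic derivative of a positive solution of `u'' = -k²u`. The Riccati equation gives `g'²
  -- - k²g² - (g²ψ)' = (g' - gψ)²`. The phase `θ > 0` keeps `ψ` finite at `x₀`.
  set ψ : ℝ → ℝ := fun x =>
    k * (Real.cos (k * (x - x₀) + θ) / Real.sin (k * (x - x₀) + θ)) with hψ
  have hψd : ∀ x ∈ Set.Icc x₀ p, HasDerivAt ψ (-k ^ 2 - ψ x ^ 2) x := fun x hx => by
    have hs := (hsin x hx).ne'
    have h := (((hang x).cos).div ((hang x).sin) hs).const_mul k
    refine h.congr_deriv ?_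
    simp only [hψ]
    field_simp
  have key := intervalIntegral.sub_le_integral_of_hasDeriv_right_of_le
    (g := fun x => g x ^ 2 * ψ x)
    (g' := fun x => 2 * g x * g' x * ψ x + g x ^ 2 * (-k ^ 2 - ψ x ^ 2))
    (φ := fun x => g' x ^ 2 - k ^ 2 * g x ^ 2) hx₀
    (fun x hx => (((hg x).pow 2).mul (hψd x hx)).continuousAt.continuousWithinAt)
    (fun x hx => by
      have := ((hg x).pow 2).mul (hψd x (Set.Ioo_subset_Icc_self hx))
      refine HasDerivAt.hasDerivWithinAt (this.congr_deriv ?_)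
      simp)
    (Continuous.integrableOn_Icc (by fun_prop))
    (fun x hx => by
      nlinarith [sq_nonneg (g' x - g x * ψ x)])
  refine le_trans ?_ key
  simp only [hg0]
  -- Here `ψ p = k tan δ`.
  have hψp : k * δ ≤ ψ p := by
    simp only [hψ]
    rw [hkp, show Real.pi / 2 - δ - θ + θ = Real.pi / 2 - δ by ring, Real.cos_pi_div_two_sub,
      Real.sin_pi_div_two_sub, ← Real.tan_eq_sin_div_cos]
    have h0 : 0 ≤ k * (p - x₀) := mul_nonneg hk.le (by linarith)
    exact mul_le_mul_of_nonneg_left (Real.lt_tan hδ (by linarith)).le hk.le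
  nlinarith [sq_nonneg (g p)]

/-- Weighted Hardy inequality on the Gaussian tail, with a boundary term. -/
lemma tail_part_bound {α β t : ℝ} (hα : 0 < α) (hβ : 0 < β) (ht : 0 < t)
    {g g' : ℝ → ℝ} (hg : ∀ x, HasDerivAt g (g' x) x) (hg' : Continuous g')
    {B B' : ℝ} (hB : ∀ x, |g x| ≤ B) (hB' : ∀ x, |g' x| ≤ B') {κ k : ℝ} (hκ : 0 ≤ κ)
    (hkκ : k ^ 2 + κ ^ 2 * tailMass α t ^ 2 ≤ κ) :
    -(κ * tailMass α t * g (Real.pi / 2) ^ 2) ≤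
      ∫ x in Set.Ioi (Real.pi / 2), (g' x ^ 2 - k ^ 2 * g x ^ 2) * gibbsWeight α β t x := by
  have hgc : Continuous g := continuous_iff_continuousAt.2 fun x => (hg x).continuousAt
  have hw := continuous_gibbsWeight α β t
  have hwi := integrable_gibbsWeight hα hβ ht
  set m := tailMass α t with hm
  have hm0 : 0 ≤ m := tailMass_nonneg α t
  set p := Real.pi / 2 with hp
  set w := gibbsWeight α β t with hwdef
  -- The tail mass beyond `x` for `x ≥ p`, in a form differentiable everywhere. The primitive
  -- compared with the energy is `κ g² T`: since `T ≤ m w`, its derivative is at most `(g'² + κ²m²g²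
  -- - κg²) w`, which `hkκ` bounds by the integrand.
  set T : ℝ → ℝ := fun x => m - ∫ y in p..x, w y with hT
  have hTd : ∀ x, HasDerivAt T (-w x) x := fun x => by
    simpa using (hw.integral_hasStrictDerivAt p x).hasDerivAt.const_sub m
  have hTeq : ∀ x, p ≤ x → T x = ∫ y in Set.Ioi x, w y := fun x hx => by
    have h := intervalIntegral.integral_interval_add_Ioi (a := p) (b := x) (f := w)
      hwi.integrableOn hwi.integrableOn
    rw [integral_gibbsWeight_Ioi] at h
    simp only [hT]
    linarith
  have hT0 : ∀ x, p ≤ x → 0 ≤ T x := fun x hx => by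
    rw [hTeq x hx]
    exact setIntegral_nonneg measurableSet_Ioi fun y _ => (gibbsWeight_pos _ _ _ _).le
  have hTm : ∀ x, p ≤ x → T x ≤ m * w x := fun x hx => by
    rw [hTeq x hx]
    exact integral_gibbsWeight_Ioi_le hα hβ ht hx
  have hint := integrable_energy_sub hα hβ ht hgc hg' hB hB' k
  refine ge_of_tendsto
    (intervalIntegral_tendsto_integral_Ioi p hint.integrableOn tendsto_id) ?_
  filter_upwards [eventually_ge_atTop p] with R hR
  have key := intervalIntegral.sub_le_integral_of_hasDeriv_right_of_le
    (g := fun x => g x ^ 2 * (κ * T x))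
    (g' := fun x => 2 * g x * g' x * (κ * T x) + g x ^ 2 * (κ * -w x))
    (φ := fun x => (g' x ^ 2 - k ^ 2 * g x ^ 2) * w x) hR
    (fun x hx => (((hg x).pow 2).mul ((hTd x).const_mul κ)).continuousAt.continuousWithinAt)
    (fun x hx => by
      have := ((hg x).pow 2).mul ((hTd x).const_mul κ)
      refine HasDerivAt.hasDerivWithinAt (this.congr_deriv ?_)
      simp)
    hint.integrableOn
    (fun x hx => by
      have hw0 : 0 < w x := gibbsWeight_pos _ _ _ _
      have h1 : 2 * g x * g' x * (κ * T x) ≤ (g' x ^ 2 + κ ^ 2 * m ^ 2 * g x ^ 2) * w x := by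
        calc 2 * g x * g' x * (κ * T x) ≤ |2 * g x * g' x * κ| * T x := by
              rw [← mul_assoc]
              exact mul_le_mul_of_nonneg_right (le_abs_self _) (hT0 x hx.1.le)
          _ ≤ |2 * g x * g' x * κ| * (m * w x) :=
              mul_le_mul_of_nonneg_left (hTm x hx.1.le) (abs_nonneg _)
          _ = (2 * |g' x| * (κ * m * |g x|)) * w x := by
              rw [abs_mul, abs_mul, abs_mul, abs_of_nonneg hκ, abs_of_pos (two_pos : (0 : ℝ) < 2)]
              ring
          _ ≤ _ := by
              refine mul_le_mul_of_nonneg_right ?_ hw0.le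
              have := sq_nonneg (|g' x| - κ * m * |g x|)
              nlinarith [sq_abs (g x), sq_abs (g' x)]
      have h2 : (k ^ 2 + κ ^ 2 * m ^ 2) * (g x ^ 2 * w x) ≤ κ * (g x ^ 2 * w x) :=
        mul_le_mul_of_nonneg_right hkκ (by positivity)
      linarith)
  have hTp : T p = m := by simp [hT]
  refine le_trans ?_ key
  simp only [hTp]
  have : 0 ≤ g R ^ 2 * (κ * T R) := mul_nonneg (sq_nonneg _) (mul_nonneg hκ (hT0 R hR))
  linarith

/-- Half-line Poincaré inequality with a Dirichlet condition at `x₀`. -/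
lemma half_line_poincare {α β t : ℝ} (hα : 0 < α) (hβ : 0 < β) (ht : 0 < t)
    {g g' : ℝ → ℝ} (hg : ∀ x, HasDerivAt g (g' x) x) (hg' : Continuous g')
    {B B' : ℝ} (hB : ∀ x, |g x| ≤ B) (hB' : ∀ x, |g' x| ≤ B') {x₀ k θ : ℝ}
    (h₁ : -(Real.pi / 2) ≤ x₀) (h₂ : x₀ ≤ Real.pi / 2) (hg0 : g x₀ = 0) (hk : 0 < k) (hk1 : k ≤ 1)
    (hθ : 0 < θ) (hm : tailMass α t ≤ 1 / 3)
    (hkp : k * (Real.pi / 2 - x₀) =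
      Real.pi / 2 - (1 + 2 * tailMass α t ^ 2) * tailMass α t - θ) :
    0 ≤ ∫ x in Set.Ioi x₀, (g' x ^ 2 - k ^ 2 * g x ^ 2) * gibbsWeight α β t x := by
  have hgc : Continuous g := continuous_iff_continuousAt.2 fun x => (hg x).continuousAt
  have hm0 : 0 < tailMass α t := by
    have := Real.pi_pos
    unfold tailMass; positivity
  have hint := integrable_energy_sub hα hβ ht hgc hg' hB hB' k
  rw [← intervalIntegral.integral_interval_add_Ioi (b := Real.pi / 2) hint.integrableOn
    hint.integrableOn]
  set m := tailMass α t with hmdef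
  have hin := flat_part_bound hg hg' h₂ hg0 hk hθ (by positivity) hkp
  -- With this `κ`, `κ m = k δ` for `δ = (1 + 2m²) m`, so the boundary terms cancel. The excess
  -- `2m²` absorbs `κ²m²`, and changes `δ` only at order `m³`.
  have hout := tail_part_bound (κ := k * (1 + 2 * m ^ 2)) (k := k) hα hβ ht hg hg' hB hB'
    (by positivity) (by
      rw [← hmdef]
      have hm2 : m ^ 2 ≤ 1 / 9 := by nlinarith
      have h3 : (1 + 2 * m ^ 2) ^ 2 ≤ 2 := by nlinarith [sq_nonneg m]
      have h4 : k * (m ^ 2 * (1 + 2 * m ^ 2) ^ 2) ≤ 1 * (m ^ 2 * 2) := by gcongr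
      have h5 : k + k * (m ^ 2 * (1 + 2 * m ^ 2) ^ 2) ≤ 1 + 2 * m ^ 2 := by linarith
      nlinarith [mul_le_mul_of_nonneg_left h5 hk.le])
  have hcongr : ∫ x in x₀..Real.pi / 2, (g' x ^ 2 - k ^ 2 * g x ^ 2) * gibbsWeight α β t x =
      ∫ x in x₀..Real.pi / 2, (g' x ^ 2 - k ^ 2 * g x ^ 2) := by
    refine intervalIntegral.integral_congr fun x hx => ?_
    rw [Set.uIcc_of_le h₂] at hx
    rw [gibbsWeight_of_mem (h₁.trans hx.1) hx.2, mul_one]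
  rw [hcongr]
  rw [← hmdef] at hout
  linarith

/-! ### Upper bound on the whole line. -/

/-- The wave number whose inverse square bounds the Poincaré constant from above. -/
noncomputable def flatWaveNumber (α β t : ℝ) : ℝ :=
  1 - ((1 + 2 * tailMass α t ^ 2) * tailMass α t + (1 + 2 * tailMass β t ^ 2) * tailMass β t
    + 2 * t) / Real.pi

lemma one_add_two_sq_mul_le {m : ℝ} (h0 : 0 ≤ m) (h1 : m ≤ 1 / 3) :
    (1 + 2 * m ^ 2) * m ≤ 1 / 2 := by
  have : m ^ 2 ≤ 1 / 9 := by nlinarith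
  nlinarith

lemma flatWaveNumber_pos {α β t : ℝ} (ht : t ≤ 1 / 3) (hmα : tailMass α t ≤ 1 / 3)
    (hmβ : tailMass β t ≤ 1 / 3) : 0 < flatWaveNumber α β t := by
  have h1 := one_add_two_sq_mul_le (tailMass_nonneg α t) hmα
  have h2 := one_add_two_sq_mul_le (tailMass_nonneg β t) hmβ
  have hpi := Real.pi_gt_three
  unfold flatWaveNumber
  rw [sub_pos, div_lt_one (by linarith)]
  linarith

lemma gibbsMeasure_integral (α β t : ℝ) (f : ℝ → ℝ) :
    ∫ x, f x ∂(gibbsMeasure (flatPotential α β) t) =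
      (∫ x, f x * gibbsWeight α β t x) / ∫ x, gibbsWeight α β t x := by
  rw [gibbsMeasure, integral_tilted, ← integral_div]
  refine integral_congr_ae (ae_of_all _ fun x => ?_)
  simp only [smul_eq_mul, gibbsWeight]
  ring

lemma integral_gibbsWeight_pos {α β t : ℝ} (hα : 0 < α) (hβ : 0 < β) (ht : 0 < t) :
    0 < ∫ x, gibbsWeight α β t x :=
  integral_exp_pos (integrable_gibbsWeight hα hβ ht)

/-- Poincaré inequality in unnormalised form, around the value at a well-chosen point. -/
lemma exists_center_poincare {α β t : ℝ} (hα : 0 < α) (hβ : 0 < β) (ht : 0 < t) (ht' : t ≤ 1 / 3)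
    (hmα : tailMass α t ≤ 1 / 3) (hmβ : tailMass β t ≤ 1 / 3)
    {h h' : ℝ → ℝ} (hh : ∀ x, HasDerivAt h (h' x) x) (hh' : Continuous h')
    {B B' : ℝ} (hB : ∀ x, |h x| ≤ B) (hB' : ∀ x, |h' x| ≤ B') :
    ∃ c : ℝ, 0 ≤ ∫ x, (h' x ^ 2 - flatWaveNumber α β t ^ 2 * (h x - c) ^ 2)
      * gibbsWeight α β t x := by
  have hpi := Real.pi_gt_three
  have d1 := one_add_two_sq_mul_le (tailMass_nonneg α t) hmα
  have d2 := one_add_two_sq_mul_le (tailMass_nonneg β t) hmβ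
  have p1 : 0 ≤ (1 + 2 * tailMass α t ^ 2) * tailMass α t := by
    have := tailMass_nonneg α t; positivity
  have p2 : 0 ≤ (1 + 2 * tailMass β t ^ 2) * tailMass β t := by
    have := tailMass_nonneg β t; positivity
  have hk := flatWaveNumber_pos ht' hmα hmβ
  have hkpi : flatWaveNumber α β t * Real.pi = Real.pi -
      ((1 + 2 * tailMass α t ^ 2) * tailMass α t + (1 + 2 * tailMass β t ^ 2) * tailMass β t
        + 2 * t) := by
    unfold flatWaveNumber; field_simp
  have hk1 : flatWaveNumber α β t ≤ 1 := by
    by_contra hcon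
    push Not at hcon
    nlinarith
  set k := flatWaveNumber α β t with hkdef
  set δ := (1 + 2 * tailMass α t ^ 2) * tailMass α t with hδ
  set ε := (1 + 2 * tailMass β t ^ 2) * tailMass β t with hε
  -- Both sides use `θ = t`, negligible against `√t`. The two phase conditions add up to `hkpi`, so
  -- fixing `x₀` by the right one forces the left one.
  obtain ⟨x₀, hx₀⟩ : ∃ x₀, k * (Real.pi / 2 - x₀) = Real.pi / 2 - δ - t :=
    ⟨Real.pi / 2 - (Real.pi / 2 - δ - t) / k, by field_simp; ring⟩
  have hx₀' : k * (Real.pi / 2 - -x₀) = Real.pi / 2 - ε - t := by linarith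
  have hr : x₀ ≤ Real.pi / 2 := by
    have : 0 ≤ k * (Real.pi / 2 - x₀) := by linarith
    linarith [nonneg_of_mul_nonneg_right this hk]
  have hl : -(Real.pi / 2) ≤ x₀ := by
    have : 0 ≤ k * (Real.pi / 2 - -x₀) := by linarith
    linarith [nonneg_of_mul_nonneg_right this hk]
  have hBg : ∀ x, |h x - h x₀| ≤ B + B := fun x =>
    (abs_sub _ _).trans (add_le_add (hB x) (hB x₀))
  have hhc : Continuous h := continuous_iff_continuousAt.2 fun x => (hh x).continuousAt
  have hright := half_line_poincare (g := fun x => h x - h x₀) (g' := h') hα hβ ht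
    (fun x => (hh x).sub_const _) hh' hBg hB' hl hr (sub_self _) hk hk1 ht hmα hx₀
  have hleft := half_line_poincare (α := β) (β := α) (g := fun x => h (-x) - h x₀)
    (g' := fun x => -h' (-x)) (B := B + B) (B' := B') hβ hα ht
    (fun x => by
      have := ((hh (-x)).comp x (hasDerivAt_neg x)).sub_const (h x₀)
      simpa using this) (by fun_prop) (fun x => hBg _)
    (fun x => by simpa using hB' (-x)) (neg_le_neg hr) (by linarith : -x₀ ≤ Real.pi / 2)
    (by simp) hk hk1 ht hmβ hx₀'
  have hint := integrable_energy_sub hα hβ ht (g := fun x => h x - h x₀) (g' := h')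
    (by fun_prop) hh' hBg hB' k
  refine ⟨h x₀, ?_⟩
  rw [← intervalIntegral.integral_Iic_add_Ioi (b := x₀) hint.integrableOn hint.integrableOn]
  refine add_nonneg ?_ hright
  have := integral_comp_neg_Ioi (-x₀)
    (fun x => (h' x ^ 2 - k ^ 2 * (h x - h x₀) ^ 2) * gibbsWeight α β t x)
  rw [neg_neg] at this
  rw [← this]
  simpa [gibbsWeight_neg] using hleft

lemma satisfiesPoincare_flat {α β t : ℝ} (hα : 0 < α) (hβ : 0 < β) (ht : 0 < t) (ht' : t ≤ 1 / 3)
    (hmα : tailMass α t ≤ 1 / 3) (hmβ : tailMass β t ≤ 1 / 3) :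
    SatisfiesPoincare (gibbsMeasure (flatPotential α β) t)
      (Real.toNNReal (1 / flatWaveNumber α β t ^ 2)) := by
  intro h hh hc
  have hk := flatWaveNumber_pos ht' hmα hmβ
  have hdc : Continuous (deriv h) := hh.continuous_deriv (by simp)
  have hhc : Continuous h := hh.continuous
  obtain ⟨B, hB⟩ := hc.exists_bound_of_continuous hhc
  obtain ⟨B', hB'⟩ := hc.deriv.exists_bound_of_continuous hdc
  simp only [Real.norm_eq_abs] at hB hB'
  obtain ⟨c, hcen⟩ := exists_center_poincare hα hβ ht ht' hmα hmβ
    (fun x => (hh.differentiable (by simp) x).hasDerivAt) hdc hB hB'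
  have hZ := integral_gibbsWeight_pos hα hβ ht
  have hw := integrable_gibbsWeight hα hβ ht
  rw [Real.coe_toNNReal _ (by positivity), gibbsMeasure_integral, gibbsMeasure_integral,
    gibbsMeasure_integral]
  set k := flatWaveNumber α β t
  set Z := ∫ x, gibbsWeight α β t x with hZdef
  have i1 : Integrable fun x => h x * gibbsWeight α β t x :=
    integrable_mul_gibbsWeight hα hβ ht hhc hB
  have i2 : Integrable fun x => h x ^ 2 * gibbsWeight α β t x :=
    integrable_mul_gibbsWeight hα hβ ht (by fun_prop) (B := B ^ 2)
      fun x => by rw [abs_pow]; exact pow_le_pow_left₀ (abs_nonneg _) (hB x) 2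
  have i3 : Integrable fun x => deriv h x ^ 2 * gibbsWeight α β t x :=
    integrable_mul_gibbsWeight hα hβ ht (by fun_prop) (B := B' ^ 2)
      fun x => by rw [abs_pow]; exact pow_le_pow_left₀ (abs_nonneg _) (hB' x) 2
  have hexp : ∫ x, (deriv h x ^ 2 - k ^ 2 * (h x - c) ^ 2) * gibbsWeight α β t x =
      (∫ x, deriv h x ^ 2 * gibbsWeight α β t x) -
        k ^ 2 * ((∫ x, h x ^ 2 * gibbsWeight α β t x)
          - 2 * c * (∫ x, h x * gibbsWeight α β t x) + c ^ 2 * Z) := by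
    have j1 : Integrable fun x => h x ^ 2 * gibbsWeight α β t x
        - 2 * c * (h x * gibbsWeight α β t x) := i2.sub (i1.const_mul _)
    have j2 : Integrable fun x => h x ^ 2 * gibbsWeight α β t x
        - 2 * c * (h x * gibbsWeight α β t x) + c ^ 2 * gibbsWeight α β t x :=
      j1.add (hw.const_mul _)
    rw [hZdef, ← integral_const_mul, ← integral_const_mul,
      ← integral_sub i2 (i1.const_mul _), ← integral_add j1 (hw.const_mul _),
      ← integral_const_mul, ← integral_sub i3 (j2.const_mul _)]
    refine integral_congr_ae (ae_of_all _ fun x => ?_)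
    ring
  rw [hexp] at hcen
  set I := ∫ x, h x * gibbsWeight α β t x
  set J := ∫ x, h x ^ 2 * gibbsWeight α β t x
  set E := ∫ x, deriv h x ^ 2 * gibbsWeight α β t x
  -- The variance is at most the second moment about any `c`.
  have e1 : J / Z - (I / Z) ^ 2 ≤ (J - 2 * c * I + c ^ 2 * Z) / Z := by
    have : (J - 2 * c * I + c ^ 2 * Z) / Z - (J / Z - (I / Z) ^ 2) = (c - I / Z) ^ 2 := by
      field_simp
      ring
    linarith [sq_nonneg (c - I / Z)]
  refine e1.trans ?_
  rw [← mul_div_assoc]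
  gcongr
  rw [one_div, ← div_eq_inv_mul, le_div_iff₀ (by positivity)]
  linarith

/-! ### Expansion of Gibbs integrals at order `√t`. -/

lemma tendsto_sqrt_nhdsGT_zero : Tendsto (fun t : ℝ => √t) (𝓝[>] 0) (𝓝 0) := by
  have := (Real.continuous_sqrt.tendsto 0).mono_left (nhdsWithin_le_nhds (s := Set.Ioi (0 : ℝ)))
  simpa using this

/-- Laplace asymptotics of the contribution of the right tail. -/
lemma tendsto_right_tail {α : ℝ} (β : ℝ) (hα : 0 < α) {g : ℝ → ℝ} (hg : Continuous g) {B : ℝ}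
    (hB : ∀ x, |g x| ≤ B) :
    Tendsto (fun t => (∫ x in Set.Ioi (Real.pi / 2), g x * gibbsWeight α β t x) / √t) (𝓝[>] 0)
      (𝓝 (g (Real.pi / 2) * √(Real.pi / (2 * α)))) := by
  have hscale : ∀ t : ℝ, 0 < t →
      (∫ x in Set.Ioi (Real.pi / 2), g x * gibbsWeight α β t x) / √t =
        ∫ x in Set.Ioi (0 : ℝ), g (√t * x + Real.pi / 2) * Real.exp (-(α / 2) * x ^ 2) := by
    intro t ht
    have hs := Real.sqrt_pos.2 ht
    rw [← zero_add (Real.pi / 2), setIntegral_Ioi_eq_shift, div_eq_inv_mul, ← smul_eq_mul]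
    -- Rescaling by `√t` makes the Gaussian independent of `t`, ready for dominated convergence.
    have := integral_comp_mul_left_Ioi
      (fun x => g (x + (0 + Real.pi / 2)) * Real.exp (-(α / (2 * t)) * x ^ 2)) 0 hs
    rw [mul_zero] at this
    have hcongr : ∫ x in Set.Ioi (0 : ℝ), g (x + Real.pi / 2) * gibbsWeight α β t (x + Real.pi / 2)
        = ∫ x in Set.Ioi (0 : ℝ),
          g (x + (0 + Real.pi / 2)) * Real.exp (-(α / (2 * t)) * x ^ 2) := by
      refine setIntegral_congr_fun measurableSet_Ioi fun x hx => ?_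
      simp only [Set.mem_Ioi] at hx
      rw [gibbsWeight_of_ge (by linarith)]
      simp
    rw [hcongr, ← this]
    refine setIntegral_congr_fun measurableSet_Ioi fun x _ => ?_
    congr 2
    rw [mul_pow, Real.sq_sqrt ht.le]
    field_simp
  have hlim : g (Real.pi / 2) * √(Real.pi / (2 * α)) =
      ∫ x in Set.Ioi (0 : ℝ), g (Real.pi / 2) * Real.exp (-(α / 2) * x ^ 2) := by
    rw [integral_const_mul, integral_gaussian_Ioi]
    have := tailMass_eq hα one_pos
    rw [tailMass, Real.sqrt_one, mul_one, mul_one] at this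
    rw [this]
  rw [hlim]
  have hdct : Tendsto (fun t : ℝ => ∫ x in Set.Ioi (0 : ℝ),
      g (√t * x + Real.pi / 2) * Real.exp (-(α / 2) * x ^ 2)) (𝓝[>] 0)
      (𝓝 (∫ x in Set.Ioi (0 : ℝ), g (Real.pi / 2) * Real.exp (-(α / 2) * x ^ 2))) := by
    refine tendsto_integral_filter_of_dominated_convergence
      (fun x => B * Real.exp (-(α / 2) * x ^ 2)) (Eventually.of_forall fun t => ?_)
      (Eventually.of_forall fun t => ae_of_all _ fun x => ?_) ?_ (ae_of_all _ fun x => ?_)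
    · exact Continuous.aestronglyMeasurable (by fun_prop)
    · rw [norm_mul, Real.norm_of_nonneg (Real.exp_pos _).le]
      exact mul_le_mul_of_nonneg_right (hB _) (Real.exp_pos _).le
    · exact ((integrable_exp_neg_mul_sq (by positivity)).const_mul _).integrableOn
    · refine Tendsto.mul_const _ ((hg.tendsto _).comp ?_)
      simpa using (tendsto_sqrt_nhdsGT_zero.mul_const x).add_const (Real.pi / 2)
  refine hdct.congr' ?_
  filter_upwards [self_mem_nhdsWithin] with t ht
  exact (hscale t ht).symm

lemma integral_gibbsWeight_split {α β t : ℝ} (hα : 0 < α) (hβ : 0 < β) (ht : 0 < t)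
    {g : ℝ → ℝ} (hg : Continuous g) {B : ℝ} (hB : ∀ x, |g x| ≤ B) :
    ∫ x, g x * gibbsWeight α β t x =
      (∫ x in -(Real.pi / 2)..Real.pi / 2, g x)
        + (∫ x in Set.Ioi (Real.pi / 2), g x * gibbsWeight α β t x)
        + ∫ x in Set.Ioi (Real.pi / 2), g (-x) * gibbsWeight β α t x := by
  have hpi := Real.pi_pos
  have hint := integrable_mul_gibbsWeight hα hβ ht hg hB
  rw [← intervalIntegral.integral_Iic_add_Ioi (b := -(Real.pi / 2)) hint.integrableOn
    hint.integrableOn, ← intervalIntegral.integral_interval_add_Ioi (b := Real.pi / 2)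
    hint.integrableOn hint.integrableOn, ← integral_comp_neg_Ioi]
  simp only [gibbsWeight_neg]
  have : ∫ x in -(Real.pi / 2)..Real.pi / 2, g x * gibbsWeight α β t x =
      ∫ x in -(Real.pi / 2)..Real.pi / 2, g x := by
    refine intervalIntegral.integral_congr fun x hx => ?_
    rw [Set.uIcc_of_le (by linarith)] at hx
    rw [gibbsWeight_of_mem hx.1 hx.2, mul_one]
  rw [this]
  ring

/-- First-order expansion in `√t` of integrals against the Gibbs weight. -/
lemma tendsto_integral_gibbsWeight_slope {α β : ℝ} (hα : 0 < α) (hβ : 0 < β)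
    {g : ℝ → ℝ} (hg : Continuous g) {B : ℝ} (hB : ∀ x, |g x| ≤ B) :
    Tendsto (fun t => ((∫ x, g x * gibbsWeight α β t x)
        - ∫ x in -(Real.pi / 2)..Real.pi / 2, g x) / √t) (𝓝[>] 0)
      (𝓝 (g (Real.pi / 2) * √(Real.pi / (2 * α))
        + g (-(Real.pi / 2)) * √(Real.pi / (2 * β)))) := by
  have h1 := tendsto_right_tail β hα hg hB
  have h2 := tendsto_right_tail (g := fun x => g (-x)) α hβ (by fun_prop) (fun x => hB (-x))
  refine (h1.add h2).congr' ?_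
  filter_upwards [self_mem_nhdsWithin] with t ht
  rw [integral_gibbsWeight_split hα hβ ht hg hB, ← add_div]
  congr 1
  ring

lemma tendsto_integral_gibbsWeight {α β : ℝ} (hα : 0 < α) (hβ : 0 < β)
    {g : ℝ → ℝ} (hg : Continuous g) {B : ℝ} (hB : ∀ x, |g x| ≤ B) :
    Tendsto (fun t => ∫ x, g x * gibbsWeight α β t x) (𝓝[>] 0)
      (𝓝 (∫ x in -(Real.pi / 2)..Real.pi / 2, g x)) := by
  have h := ((tendsto_integral_gibbsWeight_slope hα hβ hg hB).mul
    tendsto_sqrt_nhdsGT_zero).add_const (∫ x in -(Real.pi / 2)..Real.pi / 2, g x)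
  rw [mul_zero, zero_add] at h
  refine h.congr' ?_
  filter_upwards [self_mem_nhdsWithin] with t ht
  have hs := (Real.sqrt_pos.2 ht).ne'
  field_simp
  ring

/-! ### Lower bound by a test function. -/

/-- A compactly supported smooth function that coincides with the sine on `(-3, 3)`. -/
lemma exists_sine_cutoff : ∃ h : ℝ → ℝ, ContDiff ℝ ∞ h ∧ HasCompactSupport h ∧
    ∀ x ∈ Set.Ioo (-3 : ℝ) 3, h x = Real.sin x ∧ deriv h x = Real.cos x := by
  -- Radius 3 exceeds `π/2`, so the cutoff is invisible on the flat part and near its endpoints.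
  let f : ContDiffBump (0 : ℝ) := ⟨3, 4, by norm_num, by norm_num⟩
  have heq : ∀ x ∈ Set.Ioo (-3 : ℝ) 3, f x * Real.sin x = Real.sin x := fun x hx => by
    rw [f.one_of_mem_closedBall, one_mul]
    simp only [Metric.mem_closedBall, dist_zero_right, Real.norm_eq_abs]
    exact abs_le.2 ⟨hx.1.le, hx.2.le⟩
  refine ⟨fun x => f x * Real.sin x, f.contDiff.mul Real.contDiff_sin,
    f.hasCompactSupport.mul_right, fun x hx => ⟨heq x hx, ?_⟩⟩
  have : (fun x => f x * Real.sin x) =ᶠ[𝓝 x] Real.sin := by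
    filter_upwards [isOpen_Ioo.mem_nhds hx] with y hy using heq y hy
  rw [this.deriv_eq, Real.deriv_sin]

/-- The Poincaré constant is bounded below by a function with the expected expansion. -/
lemma exists_lower_bound {α β : ℝ} (hα : 0 < α) (hβ : 0 < β) :
    ∃ l : ℝ → ℝ, Tendsto (fun t => (l t - 1) / √t) (𝓝[>] 0)
        (𝓝 ((√(Real.pi / (2 * α)) + √(Real.pi / (2 * β))) / (Real.pi / 2))) ∧
      ∀ᶠ t in 𝓝[>] 0, ∀ C : ℝ≥0,
        SatisfiesPoincare (gibbsMeasure (flatPotential α β) t) C → l t ≤ C := by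
  have hpi := Real.pi_pos
  have hpi3 := Real.pi_lt_d2
  obtain ⟨h, hh, hc, hsin⟩ := exists_sine_cutoff
  have hdc : Continuous (deriv h) := hh.continuous_deriv (by simp)
  have hhc : Continuous h := hh.continuous
  obtain ⟨B, hB⟩ := hc.exists_bound_of_continuous hhc
  obtain ⟨B', hB'⟩ := hc.deriv.exists_bound_of_continuous hdc
  simp only [Real.norm_eq_abs] at hB hB'
  have hsq : ∀ x, |h x ^ 2| ≤ B ^ 2 := fun x => by
    rw [abs_pow]; exact pow_le_pow_left₀ (abs_nonneg _) (hB x) 2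
  have hsq' : ∀ x, |deriv h x ^ 2| ≤ B' ^ 2 := fun x => by
    rw [abs_pow]; exact pow_le_pow_left₀ (abs_nonneg _) (hB' x) 2
  have hin : ∀ x ∈ Set.uIcc (-(Real.pi / 2)) (Real.pi / 2),
      h x = Real.sin x ∧ deriv h x = Real.cos x := fun x hx => by
    rw [Set.uIcc_of_le (by linarith)] at hx
    exact hsin x ⟨by linarith [hx.1], by linarith [hx.2]⟩
  have hr := hin (Real.pi / 2) Set.right_mem_uIcc
  have hl := hin (-(Real.pi / 2)) Set.left_mem_uIcc
  rw [Real.sin_pi_div_two, Real.cos_pi_div_two] at hr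
  rw [Real.sin_neg, Real.cos_neg, Real.sin_pi_div_two, Real.cos_pi_div_two] at hl
  set Z : ℝ → ℝ := fun t => ∫ x, gibbsWeight α β t x with hZ
  set I : ℝ → ℝ := fun t => ∫ x, h x * gibbsWeight α β t x with hI
  set J : ℝ → ℝ := fun t => ∫ x, h x ^ 2 * gibbsWeight α β t x with hJ
  set E : ℝ → ℝ := fun t => ∫ x, deriv h x ^ 2 * gibbsWeight α β t x with hE
  have hZlim : Tendsto Z (𝓝[>] 0) (𝓝 Real.pi) := by
    have := tendsto_integral_gibbsWeight hα hβ (g := fun _ => 1) (B := 1) (by fun_prop) (by simp)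
    simpa using this
  have hElim : Tendsto E (𝓝[>] 0) (𝓝 (Real.pi / 2)) := by
    have := tendsto_integral_gibbsWeight hα hβ (g := fun x => deriv h x ^ 2) (by fun_prop) hsq'
    rw [intervalIntegral.integral_congr (g := fun x => Real.cos x ^ 2)
      (fun x hx => by simp only [(hin x hx).2])] at this
    simpa [integral_cos_sq] using this
  -- Sine is odd, so the order-zero term vanishes and `I² / Z` is `O(t)`.
  have hIlim : Tendsto (fun t => I t / √t) (𝓝[>] 0)
      (𝓝 (√(Real.pi / (2 * α)) - √(Real.pi / (2 * β)))) := by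
    have := tendsto_integral_gibbsWeight_slope hα hβ hhc hB
    rw [intervalIntegral.integral_congr (g := Real.sin) (fun x hx => (hin x hx).1),
      hr.1, hl.1] at this
    simpa [sub_eq_add_neg] using this
  -- `sin² - cos²` integrates to 0 over the flat part and equals 1 at both endpoints, so only the
  -- tail masses remain.
  have hJE : Tendsto (fun t => (J t - E t) / √t) (𝓝[>] 0)
      (𝓝 (√(Real.pi / (2 * α)) + √(Real.pi / (2 * β)))) := by
    have := tendsto_integral_gibbsWeight_slope hα hβ (g := fun x => h x ^ 2 - deriv h x ^ 2)
      (B := B ^ 2 + B' ^ 2) (by fun_prop)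
      (fun x => (abs_sub _ _).trans (add_le_add (hsq x) (hsq' x)))
    rw [intervalIntegral.integral_congr (g := fun x => Real.sin x ^ 2 - Real.cos x ^ 2)
      (fun x hx => by simp only [(hin x hx).1, (hin x hx).2]), hr.1, hr.2, hl.1, hl.2,
      intervalIntegral.integral_sub (Continuous.intervalIntegrable (by fun_prop) _ _)
        (Continuous.intervalIntegrable (by fun_prop) _ _), integral_sin_sq, integral_cos_sq] at this
    simp only [Real.sin_neg, Real.cos_neg, Real.sin_pi_div_two, Real.cos_pi_div_two] at this
    norm_num at this
    refine this.congr' ?_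
    filter_upwards [self_mem_nhdsWithin] with t ht
    simp only [hJ, hE]
    rw [← integral_sub (integrable_mul_gibbsWeight hα hβ ht (by fun_prop) hsq)
      (integrable_mul_gibbsWeight hα hβ ht (by fun_prop) hsq')]
    simp only [sub_mul]
  have hEpos : ∀ᶠ t in 𝓝[>] 0, 0 < E t := hElim.eventually_const_lt (by positivity)
  refine ⟨fun t => (J t - I t ^ 2 / Z t) / E t, ?_, ?_⟩
  · have hlim := (hJE.sub (((hIlim.pow 2).mul tendsto_sqrt_nhdsGT_zero).div hZlim hpi.ne')).div
      hElim (by positivity)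
    rw [mul_zero, zero_div, sub_zero] at hlim
    refine hlim.congr' ?_
    filter_upwards [self_mem_nhdsWithin, hEpos] with t ht hEt
    have hs := (Real.sqrt_pos.2 ht).ne'
    have hZt : Z t ≠ 0 := (integral_gibbsWeight_pos hα hβ ht).ne'
    simp only [Pi.div_apply]
    field_simp
    ring
  · filter_upwards [self_mem_nhdsWithin, hEpos] with t ht hEt C hC
    have hZt : 0 < Z t := integral_gibbsWeight_pos hα hβ ht
    have := hC h hh hc
    rw [gibbsMeasure_integral, gibbsMeasure_integral, gibbsMeasure_integral] at this
    change J t / Z t - (I t / Z t) ^ 2 ≤ C * (E t / Z t) at this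
    rw [div_le_iff₀ hEt]
    have h2 := mul_le_mul_of_nonneg_right this hZt.le
    have e1 : (J t / Z t - (I t / Z t) ^ 2) * Z t = J t - I t ^ 2 / Z t := by
      field_simp
    have e2 : C * (E t / Z t) * Z t = C * E t := by
      field_simp
    rwa [e1, e2] at h2

/-! ### Matching the two bounds. -/

/-- With `s = √t` the wave number is `1 - s r(s)` for a continuous `r`, so the quotient is `r (2 - s
r) / (1 - s r)²`, which tends to `2 r(0)`. -/
lemma tendsto_upper_bound {α β : ℝ} (hα : 0 < α) (hβ : 0 < β) :
    Tendsto (fun t => (1 / flatWaveNumber α β t ^ 2 - 1) / √t) (𝓝[>] 0)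
      (𝓝 ((√(Real.pi / (2 * α)) + √(Real.pi / (2 * β))) / (Real.pi / 2))) := by
  have hpi := Real.pi_pos
  set a := √(Real.pi / (2 * α)) with ha
  set b := √(Real.pi / (2 * β)) with hb
  set r : ℝ → ℝ := fun s =>
    ((1 + 2 * (a * s) ^ 2) * a + (1 + 2 * (b * s) ^ 2) * b + 2 * s) / Real.pi with hr
  have hk : ∀ t, 0 < t → flatWaveNumber α β t = 1 - √t * r (√t) := fun t ht => by
    unfold flatWaveNumber
    rw [tailMass_eq hα ht, tailMass_eq hβ ht, ← ha, ← hb]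
    simp only [hr]
    nth_rewrite 5 [← Real.mul_self_sqrt ht.le]
    ring
  have hrc : Continuous r := by fun_prop
  have hF : ContinuousAt (fun s => r s * (2 - s * r s) / (1 - s * r s) ^ 2) 0 := by
    refine ContinuousAt.div (by fun_prop) (by fun_prop) (by simp)
  have hlim := hF.tendsto.comp tendsto_sqrt_nhdsGT_zero
  have hval : r 0 * (2 - 0 * r 0) / (1 - 0 * r 0) ^ 2 = (a + b) / (Real.pi / 2) := by
    simp only [hr]
    field_simp
    ring
  rw [hval] at hlim
  refine hlim.congr' ?_
  have hne : ∀ᶠ t in 𝓝[>] (0 : ℝ), 1 - √t * r (√t) ≠ 0 := by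
    have : ContinuousAt (fun s => 1 - s * r s) 0 := by fun_prop
    exact (this.tendsto.comp tendsto_sqrt_nhdsGT_zero).eventually_ne (by simp)
  filter_upwards [self_mem_nhdsWithin, hne] with t ht hnet
  have hs := (Real.sqrt_pos.2 ht).ne'
  rw [hk t ht]
  simp only [Function.comp]
  have hD := pow_ne_zero 2 hnet
  rw [eq_div_iff hs, div_mul_eq_mul_div, div_eq_iff hD, sub_mul, one_div_mul_cancel hD]
  ring

lemma eventually_tailMass_le {α : ℝ} (hα : 0 < α) : ∀ᶠ t in 𝓝[>] 0, tailMass α t ≤ 1 / 3 := by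
  have h := tendsto_sqrt_nhdsGT_zero.const_mul (√(Real.pi / (2 * α)))
  rw [mul_zero] at h
  filter_upwards [self_mem_nhdsWithin, h.eventually_le_const (by norm_num : (0 : ℝ) < 1 / 3)]
    with t ht h3
  rwa [tailMass_eq hα ht]

lemma slope_constant_mul_sqrt {α β t : ℝ} (hα : 0 < α) (hβ : 0 < β) :
    (1 / √α + 1 / √β) * √(2 * t / Real.pi) =
      (√(Real.pi / (2 * α)) + √(Real.pi / (2 * β))) / (Real.pi / 2) * √t := by
  have hpi := Real.pi_pos
  have e : ∀ γ : ℝ, 0 < γ → √(Real.pi / (2 * γ)) / (Real.pi / 2) = 1 / √γ * √(2 / Real.pi) := by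
    intro γ hγ
    rw [← Real.sqrt_one, ← Real.sqrt_div zero_le_one, ← Real.sqrt_mul (by positivity),
      div_eq_iff (by positivity)]
    conv_rhs => rw [← Real.sqrt_sq (by positivity : 0 ≤ Real.pi / 2)]
    rw [← Real.sqrt_mul (by positivity)]
    congr 1
    field_simp
  rw [add_div, e α hα, e β hβ, show 2 * t / Real.pi = 2 / Real.pi * t by ring,
    Real.sqrt_mul (by positivity)]
  ring

theorem theorem3p2 (α β : ℝ) (hα : 0 < α) (hβ : 0 < β) :
    (∀ᶠ t in 𝓝[>] (0 : ℝ), poincareConst (gibbsMeasure (flatPotential α β) t) ≠ ⊤) ∧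
    (fun t : ℝ => (poincareConst (gibbsMeasure (flatPotential α β) t)).toReal
        - (1 + (1 / √α + 1 / √β) * √(2 * t / Real.pi)))
      =o[𝓝[>] (0 : ℝ)] (fun t : ℝ => √t) := by
  have hup : ∀ᶠ t in 𝓝[>] (0 : ℝ), poincareConst (gibbsMeasure (flatPotential α β) t) ≤
      ENNReal.ofReal (1 / flatWaveNumber α β t ^ 2) := by
    filter_upwards [self_mem_nhdsWithin, eventually_tailMass_le hα, eventually_tailMass_le hβ,
      (eventually_le_nhds (by norm_num : (0 : ℝ) < 1 / 3)).filter_mono nhdsWithin_le_nhds]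
      with t ht h1 h2 h3
    exact iInf₂_le _ (satisfiesPoincare_flat hα hβ ht h3 h1 h2)
  have hfin : ∀ᶠ t in 𝓝[>] (0 : ℝ),
      poincareConst (gibbsMeasure (flatPotential α β) t) ≠ ⊤ := by
    filter_upwards [hup] with t ht
    exact ne_top_of_le_ne_top ENNReal.ofReal_ne_top ht
  refine ⟨hfin, ?_⟩
  obtain ⟨l, hl, hlow⟩ := exists_lower_bound hα hβ
  have hlim : Tendsto (fun t =>
      ((poincareConst (gibbsMeasure (flatPotential α β) t)).toReal - 1) / √t) (𝓝[>] 0)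
      (𝓝 ((√(Real.pi / (2 * α)) + √(Real.pi / (2 * β))) / (Real.pi / 2))) := by
    refine tendsto_of_tendsto_of_tendsto_of_le_of_le' hl (tendsto_upper_bound hα hβ) ?_ ?_
    · filter_upwards [hlow, hfin] with t h1 h2
      gcongr
      rw [← ENNReal.ofReal_le_iff_le_toReal h2]
      refine le_iInf₂ fun C hC => ?_
      rw [← ENNReal.ofReal_coe_nnreal]
      exact ENNReal.ofReal_le_ofReal (h1 C hC)
    · filter_upwards [hup] with t h1
      gcongr
      exact ENNReal.toReal_le_of_le_ofReal (by positivity) h1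
  have hpos : ∀ᶠ t in 𝓝[>] (0 : ℝ), √t ≠ 0 := by
    filter_upwards [self_mem_nhdsWithin] with t ht
    exact (Real.sqrt_pos.2 ht).ne'
  rw [isLittleO_iff_tendsto' (hpos.mono fun t h h0 => absurd h0 h)]
  have := hlim.sub_const ((√(Real.pi / (2 * α)) + √(Real.pi / (2 * β))) / (Real.pi / 2))
  rw [sub_self] at this
  refine this.congr' ?_
  filter_upwards [hpos] with t ht
  rw [slope_constant_mul_sqrt hα hβ, ← sub_sub, sub_div _ (_ * √t),
    mul_div_cancel_right₀ _ ht]
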